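/- Let $m,k,n$ be natural numbers, let $A\in\mathbb{R}^{m\times m}$ and $B\in\mathbb{R}^{m\times k}$ satisfy $\operatorname{rank}[B,AB,\dots,A^{m-1}B]=m$, and let $g:\mathbb{R}^k\times\mathbb{R}^m\times\mathbb{R}^n\to\mathbb{R}^n$ be bounded and Lipschitz in $(y,z)$ uniformly in $u$: there are constants $M,L$ with $\|g(u,y,z)\|\le M$ and $\|g(u,y_1,z_1)-g(u,y_2,z_2)\|\le L(\|y_1-y_2\|+\|z_1-z_2\|)$ for all arguments. Let $y_0\in\mathbb{R}^m$, $z_0\in\mathbb{R}^n$ and $T>0$. For $\varepsilon>0$ let $\mathcal{Z}_T(\varepsilon)$ be the set of all functions $z:[0,T]\to\mathbb{R}^n$ for which there are a measurable control $u:[0,T]\to\mathbb{R}^k$ and a function $y:[0,T]\to\mathbb{R}^m$ such that $y$ and $z$ are absolutely continuous and $$\varepsilon y'(t)=Ay(t)+Bu(t),\quad y(0)=y_0,\qquad z'(t)=g(u(t),y(t),z(t)),\quad z(0)=z_0,$$ where the differential equations hold for almost every $t\in[0,T]$. For $z\in\mathbb{R}^n$ let $V(z)$ be the closure of the convex hull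 of $\{g(u,y,z): u\in\mathbb{R}^k,\ y\in\mathbb{R}^m\}$, and let $\mathcal{Z}_T$ be the set of all absolutely continuous functions $z:[0,T]\to\mathbb{R}^n$ with $z(0)=z_0$ and $z'(t)\in V(z(t))$ for almost every $t\in[0,T]$. Then for every $\varepsilon>0$ (not only for small $\varepsilon$) $$\operatorname{cl}\bigl(\mathcal{Z}_T(\varepsilon)\bigr)=\mathcal{Z}_T,$$ where $\operatorname{cl}$ denotes the closure with respect to the metric of uniform convergence on $[0,T]$. -/

import Mathlib

open Set MeasureTheory

/-- The `m × (m k)` block matrix `[B, A B, …, A^(m-1) B]`; the column with index `(j, l)` is the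
`l`-th column of the block `A ^ j * B`. -/
def controllabilityMatrix {m k : ℕ} (A : Matrix (Fin m) (Fin m) ℝ) (B : Matrix (Fin m) (Fin k) ℝ) :
    Matrix (Fin m) (Fin m × Fin k) ℝ :=
  Matrix.of fun i p => (A ^ (p.1 : ℕ) * B) i p.2

/-- Carathéodory solutions on `[0, T]`, with initial values `y₀` and `z₀`, of the control system
`ε y' = A y + B u`, `z' = g (u, y, z)`: the control `u` is measurable, the states `y` and `z` are
absolutely continuous on `[0, T]`, and the two equations hold at almost every `t ∈ [0, T]`. -/
structure IsControlSolution {m k n : ℕ} (A : Matrix (Fin m) (Fin m) ℝ)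
    (B : Matrix (Fin m) (Fin k) ℝ)
    (g : EuclideanSpace ℝ (Fin k) → EuclideanSpace ℝ (Fin m) → EuclideanSpace ℝ (Fin n) →
      EuclideanSpace ℝ (Fin n))
    (y₀ : EuclideanSpace ℝ (Fin m)) (z₀ : EuclideanSpace ℝ (Fin n)) (T ε : ℝ)
    (u : ℝ → EuclideanSpace ℝ (Fin k)) (y : ℝ → EuclideanSpace ℝ (Fin m))
    (z : ℝ → EuclideanSpace ℝ (Fin n)) : Prop where
  measurable_control : Measurable u
  absolutelyContinuous_fast : AbsolutelyContinuousOnInterval y 0 T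
  absolutelyContinuous_slow : AbsolutelyContinuousOnInterval z 0 T
  initial_fast : y 0 = y₀
  initial_slow : z 0 = z₀
  fast_equation : ∀ᵐ t ∂(volume.restrict (Icc 0 T)), ∃ y' : EuclideanSpace ℝ (Fin m),
    HasDerivAt y y' t ∧ ε • y' = A.toEuclideanLin (y t) + B.toEuclideanLin (u t)
  slow_equation : ∀ᵐ t ∂(volume.restrict (Icc 0 T)), HasDerivAt z (g (u t) (y t) (z t)) t

/-- The set of `z`-components, as continuous functions on `[0, T]`, of the solutions of the control
system. -/
def slowTrajectories {m k n : ℕ} (A : Matrix (Fin m) (Fin m) ℝ) (B : Matrix (Fin m) (Fin k) ℝ)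
    (g : EuclideanSpace ℝ (Fin k) → EuclideanSpace ℝ (Fin m) → EuclideanSpace ℝ (Fin n) →
      EuclideanSpace ℝ (Fin n))
    (y₀ : EuclideanSpace ℝ (Fin m)) (z₀ : EuclideanSpace ℝ (Fin n)) (T ε : ℝ) :
    Set C(Icc (0 : ℝ) T, EuclideanSpace ℝ (Fin n)) :=
  {ζ | ∃ (u : ℝ → EuclideanSpace ℝ (Fin k)) (y : ℝ → EuclideanSpace ℝ (Fin m))
    (z : ℝ → EuclideanSpace ℝ (Fin n)),
      IsControlSolution A B g y₀ z₀ T ε u y z ∧ ∀ t : Icc (0 : ℝ) T, ζ t = z t}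

/-- `V(z)`, the closed convex hull of `g(ℝᵏ, ℝᵐ, z)`. -/
def averagedField {m k n : ℕ}
    (g : EuclideanSpace ℝ (Fin k) → EuclideanSpace ℝ (Fin m) → EuclideanSpace ℝ (Fin n) →
      EuclideanSpace ℝ (Fin n))
    (z : EuclideanSpace ℝ (Fin n)) : Set (EuclideanSpace ℝ (Fin n)) :=
  closure (convexHull ℝ {v | ∃ (u : EuclideanSpace ℝ (Fin k)) (y : EuclideanSpace ℝ (Fin m)),
    v = g u y z})

/-- The set of solutions on `[0, T]` of a differential inclusion `z' ∈ V(z)`, `z(0) = z₀`: the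
absolutely continuous functions with initial value `z₀` that satisfy the inclusion almost
everywhere. -/
def inclusionSolutions {n : ℕ} (V : EuclideanSpace ℝ (Fin n) → Set (EuclideanSpace ℝ (Fin n)))
    (z₀ : EuclideanSpace ℝ (Fin n)) (T : ℝ) :
    Set C(Icc (0 : ℝ) T, EuclideanSpace ℝ (Fin n)) :=
  {ζ | ∃ z : ℝ → EuclideanSpace ℝ (Fin n),
      AbsolutelyContinuousOnInterval z 0 T ∧ z 0 = z₀ ∧
      (∀ᵐ t ∂(volume.restrict (Icc 0 T)), ∃ v ∈ V (z t), HasDerivAt z v t) ∧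
      ∀ t : Icc (0 : ℝ) T, ζ t = z t}

/-!
Both inclusions rest on a description of the solution set of `z' ∈ V(z)` without derivatives:
`mem_inclusionSolutions_iff` says that `ζ` solves the inclusion if and only if each difference
quotient of `ζ` over `[a, b]` is within `L * M * (b - a)` of `V(ζ(a))`. Indeed `V` is
convex-valued, closed, bounded by `M` and `L`-Lipschitz, and a difference quotient is a mean of
derivatives; conversely a derivative is a limit of difference quotients. The description passes to
uniform limits, so the solution set is closed (`isClosed_inclusionSolutions_averagedField`), and
it contains the slow trajectories because `g (u, y, z) ∈ V(z)`.

For density, `ε` plays no role beyond scaling the linear system `y' = F y + G u`, because the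
controls are unbounded. By the Kalman condition every state is reachable from every other one in
an arbitrarily short time (`exists_controlledState_eq`), by a control with finitely many values;
such controls keep `t ↦ g (u t) (y t) z` measurable although `g` need not be measurable in `u`.
Hence for frozen `z` the mean of `g (u, y, z)` over a short time can be made close to any single
value `g (v, x, z)`: the control jumps almost instantly to the state `x`, equals `v` for the rest
of the time, and does so again before the state has drifted away (`exists_steers_of_le`,
`steers_smul`). The set of means that can be approximated is closed, and it is convex because
controls can be concatenated (`convex_setOf_steers`), so it contains `V(z)`.

Given a solution `z` of the inclusion, freezing it on the cells of a fine grid and steering each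
mean to the point of `V(z)` nearest to the difference quotient of `z` yields a control for which
`∫ g (u, y, z)` follows `z` uniformly (`exists_control_tracking`). The solution of `x' = g (u, y,
x)` exists by Picard iteration (`exists_caratheodory_solution`) and is close to `z` by Grönwall's
inequality (`inclusionSolutions_subset_closure`).
-/

/-! ### Absolutely continuous functions and integrals -/

section Integrals

variable {E : Type*} [NormedAddCommGroup E]

theorem intervalIntegrable_of_ae_bound {f : ℝ → E} {a b M : ℝ} (hab : a ≤ b)
    (hf : AEStronglyMeasurable f) (hM : ∀ᵐ t ∂(volume.restrict (Icc a b)), ‖f t‖ ≤ M) :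
    IntervalIntegrable f volume a b := by
  rw [intervalIntegrable_iff_integrableOn_Icc_of_le hab]
  exact ⟨hf.restrict, HasFiniteIntegral.restrict_of_bounded M (by simp) hM⟩

variable [NormedSpace ℝ E]

theorem norm_integral_le_of_ae_bound {f : ℝ → E} {a b M : ℝ} (hab : a ≤ b)
    (hM : ∀ᵐ t ∂(volume.restrict (Icc a b)), ‖f t‖ ≤ M) :
    ‖∫ t in a..b, f t‖ ≤ M * (b - a) := by
  rw [ae_restrict_iff' measurableSet_Icc] at hM
  rw [← abs_of_nonneg (sub_nonneg.2 hab)]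
  refine intervalIntegral.norm_integral_le_of_norm_le_const_ae ?_
  filter_upwards [hM] with t ht h
  rw [uIoc_of_le hab] at h
  exact ht ⟨h.1.le, h.2⟩

theorem lipschitzOnWith_integral_of_ae_bound {f : ℝ → E} {a b M : ℝ}
    (hf : AEStronglyMeasurable f) (hM : ∀ᵐ t ∂(volume.restrict (Icc a b)), ‖f t‖ ≤ M) :
    LipschitzOnWith M.toNNReal (fun x => ∫ t in a..x, f t) (Icc a b) := by
  refine LipschitzOnWith.of_dist_le_mul fun x hx y hy => ?_
  wlog hxy : x ≤ y generalizing x y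
  · rw [dist_comm, dist_comm x]
    exact this y hy x hx (le_of_not_ge hxy)
  have hi : ∀ c ∈ Icc a b, IntervalIntegrable f volume a c := fun c hc =>
    intervalIntegrable_of_ae_bound hc.1 hf
      (ae_restrict_of_ae_restrict_of_subset (Icc_subset_Icc_right hc.2) hM)
  rw [dist_comm, dist_eq_norm, intervalIntegral.integral_interval_sub_left (hi y hy) (hi x hx),
    dist_comm, Real.dist_eq, abs_of_nonneg (sub_nonneg.2 hxy)]
  refine (norm_integral_le_of_ae_bound hxy
    (ae_restrict_of_ae_restrict_of_subset (Icc_subset_Icc hx.1 hy.2) hM)).trans ?_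
  exact mul_le_mul_of_nonneg_right (Real.le_coe_toNNReal M) (sub_nonneg.2 hxy)

/-- The fundamental theorem of calculus for vector-valued absolutely continuous functions with a
bounded derivative. (Mathlib's version is for real-valued functions.) -/
theorem AbsolutelyContinuousOnInterval.integral_deriv_eq_sub_of_ae_bound [FiniteDimensional ℝ E]
    {f : ℝ → E} {a b M : ℝ} (hab : a ≤ b) (hf : AbsolutelyContinuousOnInterval f a b)
    (hd : ∀ᵐ t ∂(volume.restrict (Icc a b)), DifferentiableAt ℝ f t)
    (hM : ∀ᵐ t ∂(volume.restrict (Icc a b)), ‖deriv f t‖ ≤ M) :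
    ∫ t in a..b, deriv f t = f b - f a := by
  have : CompleteSpace E := FiniteDimensional.complete ℝ E
  have hmeas : AEStronglyMeasurable (deriv f) := aestronglyMeasurable_deriv f volume
  have hint : IntervalIntegrable (deriv f) volume a b :=
    intervalIntegrable_of_ae_bound hab hmeas hM
  have hlip := lipschitzOnWith_integral_of_ae_bound (a := a) (b := b) hmeas hM
  rw [← uIcc_of_le hab] at hlip hd
  rw [ae_restrict_iff' measurableSet_uIcc] at hd
  obtain ⟨C, hC⟩ := (hf.sub hlip.absolutelyContinuousOnInterval).const_of_ae_hasDerivAt_zero (by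
    filter_upwards [hd, hint.ae_hasDerivAt_integral] with t h1 h2 ht
    simpa using (h1 ht).hasDerivAt.sub (h2 ht a left_mem_uIcc))
  have ha := hC a left_mem_uIcc
  have hb := hC b right_mem_uIcc
  simp only [Pi.sub_apply, intervalIntegral.integral_same, sub_zero] at ha hb
  rw [ha, ← hb]
  abel

/-- Grönwall's inequality in integral form. -/
theorem le_mul_exp_of_le_add_integral {e : ℝ → ℝ} (he : Continuous e) {c K T : ℝ} (hK : 0 ≤ K)
    (h : ∀ t ∈ Icc 0 T, e t ≤ c + K * ∫ s in 0..t, e s) :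
    ∀ t ∈ Icc 0 T, e t ≤ c * Real.exp (K * t) := by
  intro t ht
  have hder : ∀ x, HasDerivAt (fun x => c + K * ∫ s in 0..x, e s) (K * e x) x := fun x =>
    ((he.integral_hasStrictDerivAt 0 x).hasDerivAt.const_mul K).const_add c
  have := le_gronwallBound_of_liminf_deriv_right_le (f := fun x => c + K * ∫ s in 0..x, e s)
    (f' := fun x => K * e x) (δ := c) (K := K) (ε := 0) (a := 0) (b := T)
    (fun x _ => (hder x).continuousAt.continuousWithinAt)
    (fun x _ r hr => (hder x).hasDerivWithinAt.liminf_right_slope_le hr) (by simp)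
    (fun x hx => by
      have := mul_le_mul_of_nonneg_left (h x (Ico_subset_Icc_self hx)) hK
      simpa using this) t ht
  rw [gronwallBound_ε0, sub_zero] at this
  exact (h t ht).trans this

end Integrals

/-! ### Carathéodory differential equations -/

section Caratheodory

open scoped Nat

variable {E : Type*} [NormedAddCommGroup E]

theorem intervalIntegrable_of_bound {f : ℝ → E} {M : ℝ} (hf : AEStronglyMeasurable f)
    (hM : ∀ t, ‖f t‖ ≤ M) (a b : ℝ) : IntervalIntegrable f volume a b := by
  rw [intervalIntegrable_iff]
  exact ⟨hf.restrict, HasFiniteIntegral.restrict_of_bounded M (by simp) (by simp [hM])⟩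

variable [NormedSpace ℝ E]

theorem continuous_integral_of_bound {f : ℝ → E} {M : ℝ} (hf : AEStronglyMeasurable f)
    (hM : ∀ t, ‖f t‖ ≤ M) : Continuous fun t => ∫ s in (0 : ℝ)..t, f s :=
  intervalIntegral.continuous_primitive (intervalIntegrable_of_bound hf hM) 0

/-- Picard iteration for an equation `x' = f (t, x)` that is bounded, Lipschitz in `x` and merely
measurable in `t`: an iterate of the integral operator contracts `C([0, T], E)`. -/
theorem exists_caratheodory_solution [CompleteSpace E] {f : ℝ → E → E} {M L T : ℝ} (hT : 0 ≤ T)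
    (hL : 0 ≤ L) (hmeas : ∀ x : ℝ → E, Continuous x → AEStronglyMeasurable fun s => f s (x s))
    (hbdd : ∀ s x, ‖f s x‖ ≤ M) (hlip : ∀ s x y, ‖f s x - f s y‖ ≤ L * ‖x - y‖) (x₀ : E) :
    ∃ x : ℝ → E, Continuous x ∧ ∀ t ∈ Icc 0 T, x t = x₀ + ∫ s in 0..t, f s (x s) := by
  let ext : C(Icc 0 T, E) → ℝ → E := fun x => IccExtend hT x
  have hext : ∀ x, Continuous (ext x) := fun x => x.continuous.Icc_extend'
  have hint : ∀ (x : C(Icc 0 T, E)) (a b : ℝ),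
      IntervalIntegrable (fun s => f s (ext x s)) volume a b := fun x =>
    intervalIntegrable_of_bound (hmeas _ (hext x)) (fun s => hbdd _ _)
  let Φ : C(Icc 0 T, E) → C(Icc 0 T, E) := fun x =>
    ⟨fun t => x₀ + ∫ s in (0 : ℝ)..t, f s (ext x s), continuous_const.add
      ((continuous_integral_of_bound (hmeas _ (hext x)) (fun s => hbdd _ _)).comp
        continuous_subtype_val)⟩
  have hiter : ∀ (n : ℕ) (x y : C(Icc 0 T, E)) (t : Icc 0 T),
      ‖(Φ^[n] x) t - (Φ^[n] y) t‖ ≤ (L * t) ^ n / n ! * dist x y := by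
    intro n x y
    induction n with
    | zero =>
      intro t
      simpa [dist_eq_norm] using ContinuousMap.dist_apply_le_dist (f := x) (g := y) t
    | succ n ih =>
      intro t
      have h0 : (0 : ℝ) ≤ t := t.2.1
      have hptw : ∀ s ∈ Icc (0 : ℝ) t,
          ‖f s (ext (Φ^[n] x) s) - f s (ext (Φ^[n] y) s)‖ ≤
            L * ((L * s) ^ n / n ! * dist x y) := by
        intro s hs
        have hs' : s ∈ Icc 0 T := ⟨hs.1, hs.2.trans t.2.2⟩
        refine (hlip _ _ _).trans (mul_le_mul_of_nonneg_left ?_ hL)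
        simp only [ext, IccExtend_of_mem hT _ hs']
        exact ih ⟨s, hs'⟩
      rw [Function.iterate_succ_apply', Function.iterate_succ_apply']
      simp only [Φ, ContinuousMap.coe_mk, add_sub_add_left_eq_sub]
      rw [← intervalIntegral.integral_sub (hint _ _ _) (hint _ _ _)]
      have hcont : Continuous fun s : ℝ => L * ((L * s) ^ n / n ! * dist x y) := by fun_prop
      refine (intervalIntegral.norm_integral_le_of_norm_le h0 (g := fun s =>
        L * ((L * s) ^ n / n ! * dist x y)) ?_ (hcont.intervalIntegrable _ _)).trans ?_
      · exact Filter.Eventually.of_forall fun s hs => hptw s (Ioc_subset_Icc_self hs)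
      · have : (fun s : ℝ => L * ((L * s) ^ n / n ! * dist x y)) =
            fun s => (L ^ (n + 1) / n ! * dist x y) * s ^ n := by
          funext s; rw [mul_pow]; ring
        rw [this, intervalIntegral.integral_const_mul, integral_pow, Nat.factorial_succ]
        apply le_of_eq
        push_cast
        rw [mul_pow]
        field_simp
        simp
  obtain ⟨n, hn⟩ := ((FloorSemiring.tendsto_pow_div_factorial_atTop (L * T)).eventually
    (gt_mem_nhds zero_lt_one)).exists
  have hn0 : 0 ≤ (L * T) ^ n / n ! := by positivity
  have hcontr : ContractingWith ⟨_, hn0⟩ Φ^[n] := by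
    refine ⟨hn, LipschitzWith.of_dist_le_mul fun x y => ?_⟩
    refine (ContinuousMap.dist_le (by positivity)).2 fun t => ?_
    rw [dist_eq_norm]
    refine (hiter n x y t).trans (mul_le_mul_of_nonneg_right ?_ dist_nonneg)
    have h0 : (0 : ℝ) ≤ t := t.2.1
    have h1 : (t : ℝ) ≤ T := t.2.2
    change (L * t) ^ n / (n ! : ℝ) ≤ (L * T) ^ n / (n ! : ℝ)
    gcongr
  have hfix := hcontr.isFixedPt_fixedPoint_iterate
  set x := hcontr.fixedPoint Φ^[n]
  refine ⟨ext x, hext x, fun t ht => ?_⟩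
  have := congrArg (fun y : C(Icc 0 T, E) => y ⟨t, ht⟩) hfix.eq
  simp only [ext, IccExtend_of_mem hT _ ht]
  exact this.symm

/-- A curve given by an integral of a bounded measurable function is absolutely continuous and
solves the differential equation almost everywhere. -/
theorem ae_hasDerivAt_of_eq_add_integral [CompleteSpace E] {f x : ℝ → E} {M T : ℝ} (hT : 0 ≤ T)
    (hf : AEStronglyMeasurable f) (hM : ∀ t, ‖f t‖ ≤ M) (x₀ : E)
    (hx : ∀ t ∈ Icc 0 T, x t = x₀ + ∫ s in 0..t, f s) :
    AbsolutelyContinuousOnInterval x 0 T ∧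
      ∀ᵐ t ∂(volume.restrict (Icc 0 T)), HasDerivAt x (f t) t := by
  constructor
  · apply LipschitzOnWith.absolutelyContinuousOnInterval (K := M.toNNReal)
    rw [uIcc_of_le hT]
    have := lipschitzOnWith_integral_of_ae_bound (a := 0) (b := T) hf
      (Filter.Eventually.of_forall hM)
    refine LipschitzOnWith.of_dist_le_mul fun s hs t ht => ?_
    rw [hx s hs, hx t ht, dist_add_left]
    exact this.dist_le_mul s hs t ht
  · have hne : ∀ c : ℝ, ∀ᵐ t : ℝ, t ≠ c := fun c => by simp [ae_iff, measure_singleton]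
    rw [ae_restrict_iff' measurableSet_Icc]
    filter_upwards [(intervalIntegrable_of_bound hf hM 0 T).ae_hasDerivAt_integral, hne 0, hne T]
      with t h h0 h1 ht
    rw [uIcc_of_le hT] at h
    have hder := (h ht 0 ⟨le_rfl, hT⟩).const_add x₀
    refine hder.congr_of_eventuallyEq ?_
    filter_upwards [Icc_mem_nhds (lt_of_le_of_ne ht.1 (Ne.symm h0)) (lt_of_le_of_ne ht.2 h1)]
      with s hs using hx s hs

end Caratheodory

/-! ### The averaged field and its differential inclusion -/

section Inclusion

open Metric Filter Topology

theorem mem_cthickening_iff_infDist_le {X : Type*} [PseudoMetricSpace X] {s : Set X}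
    (hs : s.Nonempty) {δ : ℝ} (hδ : 0 ≤ δ) (x : X) : x ∈ cthickening δ s ↔ infDist x s ≤ δ := by
  rw [mem_cthickening_iff, infDist, ENNReal.le_ofReal_iff_toReal_le (infEDist_ne_top hs) hδ]

variable {m k n : ℕ}
  {g : EuclideanSpace ℝ (Fin k) → EuclideanSpace ℝ (Fin m) → EuclideanSpace ℝ (Fin n) →
      EuclideanSpace ℝ (Fin n)} {M L : ℝ}

theorem mem_averagedField (u : EuclideanSpace ℝ (Fin k)) (y : EuclideanSpace ℝ (Fin m))
    (z : EuclideanSpace ℝ (Fin n)) : g u y z ∈ averagedField g z :=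
  subset_closure (subset_convexHull ℝ _ ⟨u, y, rfl⟩)

theorem averagedField_nonempty (z : EuclideanSpace ℝ (Fin n)) : (averagedField g z).Nonempty :=
  ⟨_, mem_averagedField 0 0 z⟩

theorem isClosed_averagedField (z : EuclideanSpace ℝ (Fin n)) : IsClosed (averagedField g z) :=
  isClosed_closure

theorem convex_averagedField (z : EuclideanSpace ℝ (Fin n)) : Convex ℝ (averagedField g z) :=
  (convex_convexHull ℝ _).closure

theorem averagedField_subset {z : EuclideanSpace ℝ (Fin n)} {C : Set (EuclideanSpace ℝ (Fin n))}
    (hC : Convex ℝ C) (hC' : IsClosed C) (h : ∀ u y, g u y z ∈ C) : averagedField g z ⊆ C := by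
  refine closure_minimal (convexHull_min ?_ hC) hC'
  rintro _ ⟨u, y, rfl⟩
  exact h u y

theorem norm_le_of_mem_averagedField (hM : ∀ u y z, ‖g u y z‖ ≤ M)
    {z v : EuclideanSpace ℝ (Fin n)} (hv : v ∈ averagedField g z) : ‖v‖ ≤ M := by
  have := averagedField_subset (C := closedBall 0 M) (convex_closedBall 0 M) isClosed_closedBall
    (fun u y => by simpa using hM u y z) hv
  simpa using this

/-- The averaged field inherits the Lipschitz constant of `g`, in the Hausdorff distance. -/
theorem infDist_averagedField_le (hL : 0 ≤ L)
    (hg : ∀ u y z₁ z₂, ‖g u y z₁ - g u y z₂‖ ≤ L * ‖z₁ - z₂‖)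
    {z₁ z₂ v : EuclideanSpace ℝ (Fin n)} (hv : v ∈ averagedField g z₁) :
    infDist v (averagedField g z₂) ≤ L * ‖z₁ - z₂‖ := by
  have h0 : 0 ≤ L * ‖z₁ - z₂‖ := by positivity
  rw [← mem_cthickening_iff_infDist_le (averagedField_nonempty z₂) h0]
  refine averagedField_subset ((convex_averagedField z₂).cthickening _) isClosed_cthickening ?_ hv
  intro u y
  rw [mem_cthickening_iff_infDist_le (averagedField_nonempty z₂) h0]
  refine (infDist_le_dist_of_mem (mem_averagedField u y z₂)).trans ?_
  rw [dist_eq_norm]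
  exact hg u y z₁ z₂

theorem infDist_averagedField_le_add (hL : 0 ≤ L)
    (hg : ∀ u y z₁ z₂, ‖g u y z₁ - g u y z₂‖ ≤ L * ‖z₁ - z₂‖)
    (z₁ z₂ v : EuclideanSpace ℝ (Fin n)) :
    infDist v (averagedField g z₂) ≤ infDist v (averagedField g z₁) + L * ‖z₁ - z₂‖ := by
  obtain ⟨w, hw, hwv⟩ := (isClosed_averagedField (g := g) z₁).exists_infDist_eq_dist
    (averagedField_nonempty z₁) v
  have h1 := infDist_le_infDist_add_dist (s := averagedField g z₂) (x := v) (y := w)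
  have h2 := infDist_averagedField_le hL hg hw (z₂ := z₂)
  linarith

/-- Velocities in `V(z)` are bounded by `M`, so the fundamental theorem of calculus applies and the
solutions of the inclusion are `M`-Lipschitz. -/
theorem integral_deriv_eq_and_norm_sub_le {T : ℝ} (hM : ∀ u y z, ‖g u y z‖ ≤ M)
    {z : ℝ → EuclideanSpace ℝ (Fin n)} (hz : AbsolutelyContinuousOnInterval z 0 T)
    (hz' : ∀ᵐ t ∂(volume.restrict (Icc 0 T)), ∃ v ∈ averagedField g (z t), HasDerivAt z v t)
    {a b : ℝ} (ha : 0 ≤ a) (hab : a ≤ b) (hb : b ≤ T) :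
    ∫ t in a..b, deriv z t = z b - z a ∧ ‖z b - z a‖ ≤ M * (b - a) := by
  have hsub : Icc a b ⊆ Icc 0 T := Icc_subset_Icc ha hb
  have hz'' := ae_restrict_of_ae_restrict_of_subset hsub hz'
  have hbd : ∀ᵐ t ∂(volume.restrict (Icc a b)), ‖deriv z t‖ ≤ M := by
    filter_upwards [hz''] with t ht
    obtain ⟨v, hv, hd⟩ := ht
    rw [hd.deriv]
    exact norm_le_of_mem_averagedField hM hv
  have hac : AbsolutelyContinuousOnInterval z a b := hz.mono (by
    rwa [uIcc_of_le hab, uIcc_of_le (ha.trans (hab.trans hb))])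
  have hint := hac.integral_deriv_eq_sub_of_ae_bound hab
    (by filter_upwards [hz''] with t ht; exact ht.choose_spec.2.differentiableAt) hbd
  exact ⟨hint, hint ▸ norm_integral_le_of_ae_bound hab hbd⟩

/-- Solutions of the inclusion `z' ∈ V(z)` are the curves whose difference quotients over `[a, b]`
are within `L * M * (b - a)` of `V(z(a))`. This description has no derivatives in it, hence it is
stable under uniform limits. -/
theorem mem_inclusionSolutions_iff {T : ℝ} (hT : 0 < T) (hL : 0 ≤ L)
    (hM : ∀ u y z, ‖g u y z‖ ≤ M) (hg : ∀ u y z₁ z₂, ‖g u y z₁ - g u y z₂‖ ≤ L * ‖z₁ - z₂‖)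
    (z₀ : EuclideanSpace ℝ (Fin n)) (ζ : C(Icc (0 : ℝ) T, EuclideanSpace ℝ (Fin n))) :
    ζ ∈ inclusionSolutions (averagedField g) z₀ T ↔
      ζ ⟨0, left_mem_Icc.2 hT.le⟩ = z₀ ∧ ∀ a b : Icc (0 : ℝ) T, (a : ℝ) < b →
        infDist (((b : ℝ) - a)⁻¹ • (ζ b - ζ a)) (averagedField g (ζ a)) ≤
          L * M * ((b : ℝ) - a) := by
  have hM0 : 0 ≤ M := (norm_nonneg _).trans (hM 0 0 0)
  constructor
  · rintro ⟨z, hac, hz0, hz', hζ⟩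
    refine ⟨by rw [hζ, hz0], fun a b hab => ?_⟩
    have hr : 0 ≤ L * M * ((b : ℝ) - a) :=
      mul_nonneg (mul_nonneg hL hM0) (sub_nonneg.2 hab.le)
    rw [hζ, hζ, ← mem_cthickening_iff_infDist_le (averagedField_nonempty _) hr,
      ← (integral_deriv_eq_and_norm_sub_le hM hac hz' a.2.1 hab.le b.2.2).1,
      ← interval_average_eq]
    have hsub : Ioc (a : ℝ) b ⊆ Icc 0 T :=
      Ioc_subset_Icc_self.trans (Icc_subset_Icc a.2.1 b.2.2)
    have hz'' := ae_restrict_of_ae_restrict_of_subset hsub hz'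
    rw [uIoc_of_le hab.le]
    refine Convex.set_average_mem ((convex_averagedField _).cthickening _) isClosed_cthickening
      (by simpa using hab) (by simp) ?_ ?_
    · filter_upwards [hz'', ae_restrict_mem measurableSet_Ioc] with t ht htm
      obtain ⟨v, hv, hd⟩ := ht
      rw [hd.deriv, mem_cthickening_iff_infDist_le (averagedField_nonempty _) hr]
      refine (infDist_averagedField_le hL hg hv).trans ?_
      rw [mul_assoc]
      refine mul_le_mul_of_nonneg_left ?_ hL
      refine (integral_deriv_eq_and_norm_sub_le hM hac hz' a.2.1 htm.1.le
        (htm.2.trans b.2.2)).2.trans ?_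
      exact mul_le_mul_of_nonneg_left (sub_le_sub_right htm.2 _) hM0
    · refine ⟨(aestronglyMeasurable_deriv z volume).restrict,
        HasFiniteIntegral.restrict_of_bounded M (by simp) ?_⟩
      filter_upwards [hz''] with t ht
      obtain ⟨v, hv, hd⟩ := ht
      rw [hd.deriv]
      exact norm_le_of_mem_averagedField hM hv
  · rintro ⟨hζ0, hζ⟩
    set K := M + L * M * T with hK
    have hK0 : 0 ≤ K := by positivity
    have hslope : ∀ a b : Icc (0 : ℝ) T, (a : ℝ) < b → ‖ζ b - ζ a‖ ≤ K * ((b : ℝ) - a) := by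
      intro a b hab
      have hba : 0 < (b : ℝ) - a := sub_pos.2 hab
      obtain ⟨w, hw, hwv⟩ := (isClosed_averagedField (g := g) (ζ a)).exists_infDist_eq_dist
        (averagedField_nonempty (ζ a)) (((b : ℝ) - a)⁻¹ • (ζ b - ζ a))
      have h1 := hζ a b hab
      rw [hwv, dist_eq_norm] at h1
      have h2 := norm_le_of_mem_averagedField hM hw
      have h3 : L * M * ((b : ℝ) - a) ≤ L * M * T := by
        refine mul_le_mul_of_nonneg_left ?_ (mul_nonneg hL hM0)
        linarith [b.2.2, a.2.1]
      have h4 := norm_le_insert' (((b : ℝ) - a)⁻¹ • (ζ b - ζ a)) w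
      rw [norm_smul, norm_inv, Real.norm_of_nonneg hba.le, inv_mul_eq_div] at h4
      rw [← div_le_iff₀ hba]
      linarith
    have hlipζ : LipschitzWith K.toNNReal ζ := by
      refine LipschitzWith.of_dist_le_mul fun a b => ?_
      rw [Real.coe_toNNReal _ hK0, Subtype.dist_eq, Real.dist_eq]
      rcases lt_trichotomy (a : ℝ) b with h | h | h
      · rw [dist_comm, dist_eq_norm, abs_sub_comm, abs_of_pos (sub_pos.2 h)]
        exact hslope a b h
      · rw [Subtype.ext h]
        simp
      · rw [dist_eq_norm, abs_of_pos (sub_pos.2 h)]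
        exact hslope b a h
    have hlip := hlipζ.comp (LipschitzWith.projIcc hT.le)
    have hz : ∀ (t : ℝ) (ht : t ∈ Icc 0 T), (ζ ∘ projIcc 0 T hT.le) t = ζ ⟨t, ht⟩ := fun t ht => by
      rw [Function.comp_apply, projIcc_of_mem]
    refine ⟨ζ ∘ projIcc 0 T hT.le, hlip.lipschitzOnWith.absolutelyContinuousOnInterval,
      by rw [hz 0 (left_mem_Icc.2 hT.le), hζ0], ?_, fun t => (hz t t.2).symm⟩
    have hne : ∀ᵐ t : ℝ, t ≠ T := by simp [ae_iff, measure_singleton]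
    rw [ae_restrict_iff' measurableSet_Icc]
    filter_upwards [hlip.ae_differentiableAt_real, hne] with t hd htT ht
    refine ⟨_, ?_, hd.hasDerivAt⟩
    rw [hz t ht, (isClosed_averagedField _).mem_iff_infDist_zero (averagedField_nonempty _)]
    refine le_antisymm ?_ infDist_nonneg
    have hlim := (hasDerivAt_iff_tendsto_slope_left_right.1 hd.hasDerivAt).2
    have hlim' := ((continuous_infDist_pt (averagedField g (ζ ⟨t, ht⟩))).tendsto _).comp hlim
    have hrhs : Tendsto (fun b : ℝ => L * M * (b - t)) (𝓝[>] t) (𝓝 0) := by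
      have : Tendsto (fun b : ℝ => L * M * (b - t)) (𝓝 t) (𝓝 (L * M * (t - t))) :=
        (by fun_prop : Continuous fun b : ℝ => L * M * (b - t)).tendsto t
      rw [sub_self, mul_zero] at this
      exact this.mono_left nhdsWithin_le_nhds
    refine le_of_tendsto_of_tendsto hlim' hrhs ?_
    filter_upwards [Ioc_mem_nhdsGT (lt_of_le_of_ne ht.2 htT)] with b hb
    have hb' : b ∈ Icc 0 T := ⟨ht.1.trans hb.1.le, hb.2⟩
    have := hζ ⟨t, ht⟩ ⟨b, hb'⟩ hb.1
    simpa only [Function.comp_apply (g := slope _ _), slope, vsub_eq_sub, hz t ht,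
      hz b hb'] using this

theorem isClosed_inclusionSolutions_averagedField {T : ℝ} (hT : 0 < T) (hL : 0 ≤ L)
    (hM : ∀ u y z, ‖g u y z‖ ≤ M) (hg : ∀ u y z₁ z₂, ‖g u y z₁ - g u y z₂‖ ≤ L * ‖z₁ - z₂‖)
    (z₀ : EuclideanSpace ℝ (Fin n)) :
    IsClosed (inclusionSolutions (averagedField g) z₀ T) := by
  rw [← isSeqClosed_iff_isClosed]
  intro x ζ hx hlim
  have heval : ∀ t, Tendsto (fun j => x j t) atTop (𝓝 (ζ t)) := fun t =>
    ((continuous_eval_const t).tendsto ζ).comp hlim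
  simp only [mem_inclusionSolutions_iff hT hL hM hg] at hx ⊢
  refine ⟨tendsto_nhds_unique (heval _) (by simp [(hx _).1]), fun a b hab => ?_⟩
  have h1 : Tendsto (fun j => infDist (((b : ℝ) - a)⁻¹ • (x j b - x j a))
      (averagedField g (ζ a))) atTop
      (𝓝 (infDist (((b : ℝ) - a)⁻¹ • (ζ b - ζ a)) (averagedField g (ζ a)))) :=
    ((continuous_infDist_pt _).tendsto _).comp (((heval b).sub (heval a)).const_smul _)
  have h2 : Tendsto (fun j => L * M * ((b : ℝ) - a) + L * ‖x j a - ζ a‖) atTop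
      (𝓝 (L * M * ((b : ℝ) - a) + L * ‖ζ a - ζ a‖)) :=
    (((heval a).sub_const _).norm.const_mul L).const_add _
  rw [sub_self (ζ a), norm_zero, mul_zero, add_zero] at h2
  refine le_of_tendsto_of_tendsto' h1 h2 fun j => ?_
  exact (infDist_averagedField_le_add hL hg (x j a) (ζ a) _).trans
    (add_le_add_left ((hx j).2 a b hab) _)

end Inclusion

/-! ### Linear control systems with simple controls -/

section LinearControl

open Filter Topology

variable {X U : Type*} [NormedAddCommGroup X] [NormedSpace ℝ X]
  [NormedAddCommGroup U] [NormedSpace ℝ U]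

/-- The flow `t ↦ exp (t F)` of the linear differential equation `y' = F y`. -/
noncomputable def linearFlow (F : X →L[ℝ] X) (t : ℝ) : X →L[ℝ] X :=
  NormedSpace.exp (t • F)

@[simp]
theorem linearFlow_zero (F : X →L[ℝ] X) : linearFlow F 0 = 1 := by
  simp [linearFlow]

variable [FiniteDimensional ℝ X]

theorem linearFlow_add (F : X →L[ℝ] X) (s t : ℝ) :
    linearFlow F (s + t) = linearFlow F s * linearFlow F t := by
  have : CompleteSpace X := FiniteDimensional.complete ℝ X
  let := NormedAlgebra.restrictScalars ℚ ℝ (X →L[ℝ] X)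
  rw [linearFlow, add_smul]
  exact NormedSpace.exp_add_of_commute (((Commute.refl F).smul_left s).smul_right t)

theorem linearFlow_add_apply (F : X →L[ℝ] X) (s t : ℝ) (x : X) :
    linearFlow F (s + t) x = linearFlow F s (linearFlow F t x) := by
  rw [linearFlow_add]
  rfl

@[simp]
theorem linearFlow_neg_apply (F : X →L[ℝ] X) (t : ℝ) (x : X) :
    linearFlow F t (linearFlow F (-t) x) = x := by
  simp [← linearFlow_add_apply]

theorem hasDerivAt_linearFlow (F : X →L[ℝ] X) (t : ℝ) :
    HasDerivAt (linearFlow F) (F * linearFlow F t) t :=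
  have : CompleteSpace X := FiniteDimensional.complete ℝ X
  hasDerivAt_exp_smul_const' F t

theorem hasDerivAt_linearFlow' (F : X →L[ℝ] X) (t : ℝ) :
    HasDerivAt (linearFlow F) (linearFlow F t * F) t :=
  have : CompleteSpace X := FiniteDimensional.complete ℝ X
  hasDerivAt_exp_smul_const F t

@[fun_prop]
theorem continuous_linearFlow (F : X →L[ℝ] X) : Continuous (linearFlow F) :=
  continuous_iff_continuousAt.2 fun t => (hasDerivAt_linearFlow F t).continuousAt

/-- The solution of `y' = F y + G u`, `y 0 = y₀`, given by the variation of constants formula. -/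
noncomputable def controlledState (F : X →L[ℝ] X) (G : U →L[ℝ] X) (y₀ : X) (u : ℝ → U) (t : ℝ) :
    X :=
  linearFlow F t (y₀ + ∫ s in 0..t, linearFlow F (-s) (G (u s)))

omit [FiniteDimensional ℝ X] in
@[simp]
theorem controlledState_zero (F : X →L[ℝ] X) (G : U →L[ℝ] X) (y₀ : X) (u : ℝ → U) :
    controlledState F G y₀ u 0 = y₀ := by
  simp [controlledState]

theorem controlledState_integrand_meas_bdd (F : X →L[ℝ] X) (G : U →L[ℝ] X) (u : SimpleFunc ℝ U) :
    AEStronglyMeasurable (fun s => linearFlow F (-s) (G (u s))) ∧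
      ∀ a b, ∃ C, ∀ s ∈ Icc a b, ‖linearFlow F (-s) (G (u s))‖ ≤ C := by
  constructor
  · have hc : Continuous fun p : ℝ × U => linearFlow F (-p.1) (G p.2) := by fun_prop
    exact (hc.comp_stronglyMeasurable
      (measurable_id.stronglyMeasurable.prodMk u.stronglyMeasurable)).aestronglyMeasurable
  · intro a b
    obtain ⟨C, hC⟩ := u.exists_forall_norm_le
    obtain ⟨D, hD⟩ := (isCompact_Icc (a := a) (b := b)).exists_bound_of_continuousOn
      (f := fun s => linearFlow F (-s)) (by fun_prop)
    refine ⟨D * (‖G‖ * C), fun s hs => ?_⟩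
    have hD0 : 0 ≤ D := (norm_nonneg _).trans (hD s hs)
    calc _ ≤ ‖linearFlow F (-s)‖ * (‖G‖ * ‖u s‖) :=
          (ContinuousLinearMap.le_opNorm _ _).trans
            (mul_le_mul_of_nonneg_left (G.le_opNorm _) (norm_nonneg _))
      _ ≤ _ := mul_le_mul (hD s hs) (mul_le_mul_of_nonneg_left (hC s) (norm_nonneg _))
          (by positivity) hD0

theorem controlledState_integrand_intervalIntegrable (F : X →L[ℝ] X) (G : U →L[ℝ] X)
    (u : SimpleFunc ℝ U) (a b : ℝ) :
    IntervalIntegrable (fun s => linearFlow F (-s) (G (u s))) volume a b := by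
  obtain ⟨hm, hb⟩ := controlledState_integrand_meas_bdd F G u
  wlog hab : a ≤ b generalizing a b
  · exact (this b a (le_of_not_ge hab)).symm
  obtain ⟨C, hC⟩ := hb a b
  exact intervalIntegrable_of_ae_bound hab hm (ae_restrict_of_forall_mem measurableSet_Icc hC)

theorem continuous_controlledState (F : X →L[ℝ] X) (G : U →L[ℝ] X) (y₀ : X)
    (u : SimpleFunc ℝ U) : Continuous (controlledState F G y₀ u) := by
  have := intervalIntegral.continuous_primitive
    (controlledState_integrand_intervalIntegrable F G u) 0
  unfold controlledState
  fun_prop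

theorem absolutelyContinuousOnInterval_controlledState (F : X →L[ℝ] X) (G : U →L[ℝ] X) (y₀ : X)
    (u : SimpleFunc ℝ U) {T : ℝ} (hT : 0 ≤ T) :
    AbsolutelyContinuousOnInterval (controlledState F G y₀ u) 0 T := by
  obtain ⟨hm, hb⟩ := controlledState_integrand_meas_bdd F G u
  obtain ⟨C, hC⟩ := hb 0 T
  set c : ℝ → X := fun t => y₀ + ∫ s in 0..t, linearFlow F (-s) (G (u s))
  have hc : LipschitzOnWith C.toNNReal c (Icc 0 T) := by
    refine LipschitzOnWith.of_dist_le_mul fun s hs t ht => ?_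
    rw [dist_add_left]
    exact (lipschitzOnWith_integral_of_ae_bound hm
      (ae_restrict_of_forall_mem measurableSet_Icc hC)).dist_le_mul s hs t ht
  obtain ⟨D, hD⟩ := (isCompact_Icc (a := 0) (b := T)).exists_bound_of_continuousOn
    (f := fun s => F * linearFlow F s) (by fun_prop)
  obtain ⟨D', hD'⟩ := (isCompact_Icc (a := 0) (b := T)).exists_bound_of_continuousOn
    (f := linearFlow F) (by fun_prop)
  obtain ⟨C', hC'⟩ := (isCompact_Icc (a := 0) (b := T)).exists_bound_of_continuousOn
    hc.continuousOn
  have h0 : (0 : ℝ) ∈ Icc 0 T := ⟨le_rfl, hT⟩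
  have hD0 : 0 ≤ D := (norm_nonneg _).trans (hD 0 h0)
  have hD0' : 0 ≤ D' := (norm_nonneg _).trans (hD' 0 h0)
  have hC0' : 0 ≤ C' := (norm_nonneg _).trans (hC' 0 h0)
  apply LipschitzOnWith.absolutelyContinuousOnInterval (K := (D * C' + D' * C.toNNReal).toNNReal)
  rw [uIcc_of_le hT]
  refine LipschitzOnWith.of_dist_le_mul fun s hs t ht => ?_
  have h1 : ‖linearFlow F s - linearFlow F t‖ ≤ D * ‖s - t‖ :=
    (convex_Icc 0 T).norm_image_sub_le_of_norm_hasDerivWithin_le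
      (fun r _ => (hasDerivAt_linearFlow F r).hasDerivWithinAt) hD ht hs
  have h2 := hc.dist_le_mul s hs t ht
  rw [Real.coe_toNNReal _ (by positivity), dist_eq_norm, dist_eq_norm]
  rw [dist_eq_norm, dist_eq_norm] at h2
  calc ‖linearFlow F s (c s) - linearFlow F t (c t)‖
      = ‖(linearFlow F s - linearFlow F t) (c s) + linearFlow F t (c s - c t)‖ := by
        rw [sub_apply, map_sub]
        abel_nf
    _ ≤ (D * ‖s - t‖) * C' + D' * (C.toNNReal * ‖s - t‖) := by
        refine (norm_add_le _ _).trans (add_le_add ?_ ?_)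
        · exact (ContinuousLinearMap.le_opNorm _ _).trans
            (mul_le_mul h1 (hC' s hs) (norm_nonneg _) (by positivity))
        · exact (ContinuousLinearMap.le_opNorm _ _).trans
            (mul_le_mul (hD' t ht) h2 (norm_nonneg _) hD0')
    _ = _ := by ring

theorem ae_hasDerivAt_controlledState (F : X →L[ℝ] X) (G : U →L[ℝ] X) (y₀ : X)
    (u : SimpleFunc ℝ U) :
    ∀ᵐ t, HasDerivAt (controlledState F G y₀ u) (F (controlledState F G y₀ u t) + G (u t)) t := by
  have : CompleteSpace X := FiniteDimensional.complete ℝ X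
  have hloc : LocallyIntegrable (fun s => linearFlow F (-s) (G (u s))) := by
    rw [locallyIntegrable_iff]
    intro K hK
    obtain ⟨a, ha⟩ := hK.bddBelow
    obtain ⟨b, hb⟩ := hK.bddAbove
    refine IntegrableOn.mono_set (t := Icc a b) ?_ (fun x hx => ⟨ha hx, hb hx⟩)
    obtain ⟨hm, hbd⟩ := controlledState_integrand_meas_bdd F G u
    obtain ⟨C, hC⟩ := hbd a b
    exact ⟨hm.restrict, HasFiniteIntegral.restrict_of_bounded C (by simp)
      (ae_restrict_of_forall_mem measurableSet_Icc hC)⟩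
  filter_upwards [LocallyIntegrable.ae_hasDerivAt_integral hloc] with t ht
  have := (hasDerivAt_linearFlow F t).clm_apply ((ht 0).const_add y₀)
  rw [linearFlow_neg_apply] at this
  exact this

/-! ### Concatenation of controls -/

/-- The control that equals `u` before time `a` and then runs `v`, restarted at time `a`. -/
noncomputable def concatControl {α : Type*} (a : ℝ) (u v : SimpleFunc ℝ α) : SimpleFunc ℝ α :=
  SimpleFunc.piecewise (Iio a) measurableSet_Iio u
    (v.comp (fun s => s - a) (measurable_id.sub_const a))

theorem concatControl_of_lt {α : Type*} {a s : ℝ} (h : s < a) (u v : SimpleFunc ℝ α) :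
    concatControl a u v s = u s := by
  simp [concatControl, SimpleFunc.coe_piecewise, Set.piecewise, h]

theorem concatControl_add {α : Type*} {a s : ℝ} (h : 0 ≤ s) (u v : SimpleFunc ℝ α) :
    concatControl a u v (a + s) = v s := by
  simp [concatControl, SimpleFunc.coe_piecewise, Set.piecewise, not_lt.2 h]

theorem integral_congr_of_eq_Ioo {E : Type*} [NormedAddCommGroup E] [NormedSpace ℝ E]
    {f g : ℝ → E} {a b : ℝ} (hab : a ≤ b) (h : ∀ s ∈ Ioo a b, f s = g s) :
    ∫ s in a..b, f s = ∫ s in a..b, g s := by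
  rw [intervalIntegral.integral_of_le hab, intervalIntegral.integral_of_le hab,
    integral_Ioc_eq_integral_Ioo, integral_Ioc_eq_integral_Ioo]
  exact setIntegral_congr_fun measurableSet_Ioo h

omit [FiniteDimensional ℝ X] in
theorem controlledState_concatControl_of_le (F : X →L[ℝ] X) (G : U →L[ℝ] X) (y₀ : X)
    (u v : SimpleFunc ℝ U) {a t : ℝ} (ht : 0 ≤ t) (hta : t ≤ a) :
    controlledState F G y₀ (concatControl a u v) t = controlledState F G y₀ u t := by
  unfold controlledState
  rw [integral_congr_of_eq_Ioo ht fun s hs => by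
    rw [concatControl_of_lt (hs.2.trans_le hta)]]

theorem controlledState_concatControl_add (F : X →L[ℝ] X) (G : U →L[ℝ] X) (y₀ : X)
    (u v : SimpleFunc ℝ U) {a t : ℝ} (ha : 0 ≤ a) (ht : 0 ≤ t) :
    controlledState F G y₀ (concatControl a u v) (a + t) =
      controlledState F G (controlledState F G y₀ u a) v t := by
  have : CompleteSpace X := FiniteDimensional.complete ℝ X
  have hi := controlledState_integrand_intervalIntegrable F G (concatControl a u v)
  have hfirst : ∫ s in 0..a, linearFlow F (-s) (G (concatControl a u v s)) =
      ∫ s in 0..a, linearFlow F (-s) (G (u s)) :=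
    integral_congr_of_eq_Ioo ha fun s hs => by rw [concatControl_of_lt hs.2]
  have hsecond : ∫ s in a..(a + t), linearFlow F (-s) (G (concatControl a u v s)) =
      linearFlow F (-a) (∫ s in 0..t, linearFlow F (-s) (G (v s))) := by
    rw [← ContinuousLinearMap.intervalIntegral_comp_comm _
      (controlledState_integrand_intervalIntegrable F G v 0 t)]
    have := intervalIntegral.integral_comp_add_left (a := 0) (b := t)
      (fun s => linearFlow F (-s) (G (concatControl a u v s))) a
    rw [add_zero] at this
    rw [← this]
    refine integral_congr_of_eq_Ioo ht fun s hs => ?_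
    rw [concatControl_add hs.1.le, neg_add, linearFlow_add_apply]
  unfold controlledState
  rw [← intervalIntegral.integral_add_adjacent_intervals (hi 0 a) (hi a (a + t)), hfirst, hsecond,
    add_comm a t, linearFlow_add_apply, ← add_assoc, map_add (linearFlow F a),
    linearFlow_neg_apply]

/-! ### Controllability in arbitrarily short time -/

/-- The Kalman condition in dual form makes every state reachable from every other one in any given
time, by a simple control: a functional that annihilates the reachable states annihilates
`exp (-s F) G v` for all `s`, hence so do all its derivatives in `s`. -/
theorem exists_controlledState_eq (F : X →L[ℝ] X) (G : U →L[ℝ] X)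
    (hFG : ∀ p : X →L[ℝ] ℝ, (∀ (j : ℕ) v, p ((F ^ j) (G v)) = 0) → p = 0)
    {τ : ℝ} (hτ : 0 < τ) (y₁ y₂ : X) :
    ∃ u : SimpleFunc ℝ U, controlledState F G y₁ u τ = y₂ := by
  have : CompleteSpace X := FiniteDimensional.complete ℝ X
  have hi := controlledState_integrand_intervalIntegrable F G
  let Λ : SimpleFunc ℝ U →ₗ[ℝ] X :=
    { toFun := fun u => ∫ s in 0..τ, linearFlow F (-s) (G (u s))
      map_add' := fun u v => by
        rw [← intervalIntegral.integral_add (hi u 0 τ) (hi v 0 τ)]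
        simp
      map_smul' := fun c u => by
        rw [← intervalIntegral.integral_smul]
        simp }
  suffices hΛ : LinearMap.range Λ = ⊤ by
    obtain ⟨u, hu⟩ := LinearMap.range_eq_top.1 hΛ (linearFlow F (-τ) y₂ - y₁)
    have hu' : ∫ s in 0..τ, linearFlow F (-s) (G (u s)) = linearFlow F (-τ) y₂ - y₁ := hu
    exact ⟨u, by rw [controlledState, hu', add_sub_cancel, linearFlow_neg_apply]⟩
  by_contra hne
  obtain ⟨f, hf0, hf⟩ := Submodule.exists_le_ker_of_lt_top _ (lt_top_iff_ne_top.2 hne)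
  let p : X →L[ℝ] ℝ := LinearMap.toContinuousLinearMap f
  have hpΛ : ∀ u, p (Λ u) = 0 := fun u => hf ⟨u, rfl⟩
  have hint : ∀ v, ∀ s ∈ Icc 0 τ, ∫ r in 0..s, p (linearFlow F (-r) (G v)) = 0 := by
    intro v s hs
    let u : SimpleFunc ℝ U := SimpleFunc.piecewise (Iio s) measurableSet_Iio
      (SimpleFunc.const ℝ v) (SimpleFunc.const ℝ 0)
    have hcont : Continuous fun r => linearFlow F (-r) (G v) := by fun_prop
    have h1 : Λ u = ∫ r in 0..s, linearFlow F (-r) (G v) := by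
      change ∫ r in 0..τ, linearFlow F (-r) (G (u r)) = _
      rw [← intervalIntegral.integral_add_adjacent_intervals (hi u 0 s) (hi u s τ)]
      have h2 : ∫ r in s..τ, linearFlow F (-r) (G (u r)) = ∫ r in s..τ, (0 : X) :=
        integral_congr_of_eq_Ioo hs.2 fun r hr => by
          simp [u, SimpleFunc.coe_piecewise, Set.piecewise, not_lt.2 hr.1.le]
      rw [h2, intervalIntegral.integral_zero, add_zero]
      exact integral_congr_of_eq_Ioo hs.1 fun r hr => by
        simp [u, SimpleFunc.coe_piecewise, Set.piecewise, hr.2]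
    rw [ContinuousLinearMap.intervalIntegral_comp_comm p (hcont.intervalIntegrable _ _), ← h1]
    exact hpΛ u
  have hzero : ∀ (j : ℕ) v, ∀ s ∈ Ioo 0 τ, p (linearFlow F (-s) ((F ^ j) (G v))) = 0 := by
    intro j v
    induction j with
    | zero =>
      intro s hs
      have hcont : Continuous fun r => p (linearFlow F (-r) (G v)) := by fun_prop
      have hd := (hcont.integral_hasStrictDerivAt 0 s).hasDerivAt
      have hd' : HasDerivAt (fun t => ∫ r in 0..t, p (linearFlow F (-r) (G v))) 0 s := by
        refine (hasDerivAt_const s (0 : ℝ)).congr_of_eventuallyEq ?_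
        filter_upwards [Icc_mem_nhds hs.1 hs.2] with t ht using hint v t ht
      simpa using hd.unique hd'
    | succ j ih =>
      intro s hs
      have hd : HasDerivAt (fun t => p (linearFlow F (-t) ((F ^ j) (G v))))
          (p (-(linearFlow F (-s) (F ((F ^ j) (G v)))))) s := by
        have h1 := ((hasDerivAt_linearFlow' F (-s)).scomp s (hasDerivAt_neg s)).clm_apply
          (hasDerivAt_const s ((F ^ j) (G v)))
        have h2 := p.hasFDerivAt.comp_hasDerivAt s h1
        simpa [Function.comp_def] using h2
      have hd' : HasDerivAt (fun t => p (linearFlow F (-t) ((F ^ j) (G v)))) 0 s := by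
        refine (hasDerivAt_const s (0 : ℝ)).congr_of_eventuallyEq ?_
        filter_upwards [Ioo_mem_nhds hs.1 hs.2] with t ht using ih t ht
      have := hd.unique hd'
      rw [map_neg, neg_eq_zero] at this
      rw [pow_succ']
      exact this
  have hq := hFG (p.comp (linearFlow F (-(τ / 2)))) fun j v =>
    hzero j v (τ / 2) ⟨by linarith, by linarith⟩
  refine hf0 (LinearMap.ext fun x => ?_)
  have := DFunLike.congr_fun hq (linearFlow F (-(-(τ / 2))) x)
  rw [ContinuousLinearMap.comp_apply, ← linearFlow_add_apply, add_neg_cancel] at this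
  simpa [p] using this

end LinearControl

/-! ### Steering the mean of a function of control and state -/

section Steering

open Filter Topology

variable {X U E : Type*} [NormedAddCommGroup X] [NormedSpace ℝ X] [FiniteDimensional ℝ X]
  [NormedAddCommGroup U] [NormedSpace ℝ U] [NormedAddCommGroup E]

/-- Nothing is assumed about the dependence of `Φ` on the control value: a simple control takes
finitely many values. -/
theorem aestronglyMeasurable_simpleFunc_bind [SecondCountableTopology E] {α : Type*}
    (u : SimpleFunc ℝ α) {Φ : α → ℝ → E} (hΦ : ∀ v, Continuous (Φ v)) :
    AEStronglyMeasurable fun s => Φ (u s) s := by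
  borelize E
  exact (u.measurable_bind Φ fun v => (hΦ v).measurable).aestronglyMeasurable

variable [NormedSpace ℝ E]

theorem norm_integral_sub_smul_le [CompleteSpace E] {f : ℝ → E} {a b C : ℝ} (hab : a ≤ b) (w : E)
    (hf : IntervalIntegrable f volume a b) (hC : ∀ s ∈ Icc a b, ‖f s - w‖ ≤ C) :
    ‖(∫ s in a..b, f s) - (b - a) • w‖ ≤ C * (b - a) := by
  rw [← intervalIntegral.integral_const (a := a) (b := b) w,
    ← intervalIntegral.integral_sub hf intervalIntegrable_const]
  exact norm_integral_le_of_ae_bound hab (ae_restrict_of_forall_mem measurableSet_Icc hC)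

omit [FiniteDimensional ℝ X] in
theorem integral_concatControl_of_le (F : X →L[ℝ] X) (G : U →L[ℝ] X) (y₀ : X)
    (u v : SimpleFunc ℝ U) (φ : U → X → E) {a b c : ℝ} (hb : 0 ≤ b) (hbc : b ≤ c) (hc : c ≤ a) :
    ∫ s in b..c, φ (concatControl a u v s) (controlledState F G y₀ (concatControl a u v) s) =
      ∫ s in b..c, φ (u s) (controlledState F G y₀ u s) :=
  integral_congr_of_eq_Ioo hbc fun s hs => by
    rw [concatControl_of_lt (hs.2.trans_le hc),
      controlledState_concatControl_of_le F G y₀ u v (hb.trans hs.1.le) (hs.2.le.trans hc)]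

theorem integral_concatControl_add (F : X →L[ℝ] X) (G : U →L[ℝ] X) (y₀ : X)
    (u v : SimpleFunc ℝ U) (φ : U → X → E) {a t : ℝ} (ha : 0 ≤ a) (ht : 0 ≤ t) :
    ∫ s in a..(a + t),
        φ (concatControl a u v s) (controlledState F G y₀ (concatControl a u v) s) =
      ∫ s in 0..t, φ (v s) (controlledState F G (controlledState F G y₀ u a) v s) := by
  have := intervalIntegral.integral_comp_add_left (a := 0) (b := t)
    (fun s => φ (concatControl a u v s) (controlledState F G y₀ (concatControl a u v) s)) a
  rw [add_zero] at this
  rw [← this]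
  exact integral_congr_of_eq_Ioo ht fun s hs => by
    rw [concatControl_add hs.1.le, controlledState_concatControl_add F G y₀ u v ha hs.1.le]

/-- From every initial state, some simple control brings the integral over `[0, ℓ]` of `φ`, along
control and state, within `κ` of `w`. -/
def Steers (F : X →L[ℝ] X) (G : U →L[ℝ] X) (φ : U → X → E) (ℓ : ℝ) (w : E) (κ : ℝ) : Prop :=
  ∀ y₀ : X, ∃ u : SimpleFunc ℝ U,
    ‖(∫ s in 0..ℓ, φ (u s) (controlledState F G y₀ u s)) - w‖ ≤ κ

variable {F : X →L[ℝ] X} {G : U →L[ℝ] X} {φ : U → X → E} {M L : ℝ} [SecondCountableTopology E]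

omit [NormedSpace ℝ E] in
theorem intervalIntegrable_along_controlledState (hφc : ∀ v, Continuous (φ v))
    (hM : ∀ v x, ‖φ v x‖ ≤ M) (y₀ : X) (u : SimpleFunc ℝ U) (a b : ℝ) :
    IntervalIntegrable (fun s => φ (u s) (controlledState F G y₀ u s)) volume a b :=
  intervalIntegrable_of_bound (aestronglyMeasurable_simpleFunc_bind u
    (Φ := fun v s => φ v (controlledState F G y₀ u s))
    fun v => (hφc v).comp (continuous_controlledState F G y₀ u)) (fun _ => hM _ _) a b

theorem Steers.add (hφc : ∀ v, Continuous (φ v)) (hM : ∀ v x, ‖φ v x‖ ≤ M) {ℓ₁ ℓ₂ κ₁ κ₂ : ℝ}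
    {w₁ w₂ : E} (h₁ : Steers F G φ ℓ₁ w₁ κ₁) (h₂ : Steers F G φ ℓ₂ w₂ κ₂) (hℓ₁ : 0 ≤ ℓ₁)
    (hℓ₂ : 0 ≤ ℓ₂) : Steers F G φ (ℓ₁ + ℓ₂) (w₁ + w₂) (κ₁ + κ₂) := by
  intro y₀
  obtain ⟨u, hu⟩ := h₁ y₀
  obtain ⟨v, hv⟩ := h₂ (controlledState F G y₀ u ℓ₁)
  have hi := intervalIntegrable_along_controlledState (F := F) (G := G) hφc hM y₀
    (concatControl ℓ₁ u v)
  refine ⟨concatControl ℓ₁ u v, ?_⟩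
  rw [← intervalIntegral.integral_add_adjacent_intervals (hi 0 ℓ₁) (hi ℓ₁ (ℓ₁ + ℓ₂)),
    integral_concatControl_of_le F G y₀ u v φ le_rfl hℓ₁ le_rfl,
    integral_concatControl_add F G y₀ u v φ hℓ₁ hℓ₂, add_sub_add_comm]
  exact (norm_add_le _ _).trans (add_le_add hu hv)

theorem Steers.nsmul (hφc : ∀ v, Continuous (φ v)) (hM : ∀ v x, ‖φ v x‖ ≤ M) {ℓ κ : ℝ} {w : E}
    (h : Steers F G φ ℓ w κ) (hℓ : 0 ≤ ℓ) (N : ℕ) :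
    Steers F G φ (N * ℓ) ((N : ℝ) • w) (N * κ) := by
  induction N with
  | zero => exact fun y₀ => ⟨0, by simp⟩
  | succ N ih =>
    have := ih.add hφc hM h (by positivity) hℓ
    push_cast
    rwa [add_smul, add_mul, add_mul, one_smul, one_mul, one_mul]

/-- Over a short time `ℓ`, the mean of `φ` can be made close to any value `φ v x`: a negligible part
of the time is spent driving the state to `x`, after which the control is constantly `v`, while the
state has no time to leave a neighbourhood of `x`. -/
theorem exists_steers_of_le [CompleteSpace E]
    (hFG : ∀ p : X →L[ℝ] ℝ, (∀ (j : ℕ) v, p ((F ^ j) (G v)) = 0) → p = 0)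
    (hφc : ∀ v, Continuous (φ v)) (hM : ∀ v x, ‖φ v x‖ ≤ M) (v : U) (x : X) {η : ℝ} (hη : 0 < η) :
    ∃ ℓ₀ > 0, ∀ ℓ, 0 < ℓ → ℓ ≤ ℓ₀ → Steers F G φ ℓ (ℓ • φ v x) (η * ℓ) := by
  have hM0 : 0 ≤ M := (norm_nonneg _).trans (hM v x)
  set c : SimpleFunc ℝ U := SimpleFunc.const ℝ v
  have hcont : Continuous fun s => φ v (controlledState F G x c s) :=
    (hφc v).comp (continuous_controlledState F G x c)
  obtain ⟨ℓ₀, hℓ₀, hball⟩ := Metric.continuousAt_iff.1 (hcont.continuousAt (x := 0)) (η / 2)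
    (by positivity)
  refine ⟨ℓ₀ / 2, by positivity, fun ℓ hℓ hle y₀ => ?_⟩
  set θ : ℝ := min (1 / 2) (η / (4 * (M + 1))) with hθ
  have hθ0 : 0 < θ := lt_min (by norm_num) (by positivity)
  have hθ1 : θ ≤ 1 / 2 := min_le_left _ _
  have hθM : 2 * M * θ ≤ η / 2 := by
    have : θ * (4 * (M + 1)) ≤ η := (le_div_iff₀ (by positivity)).1 (min_le_right _ _)
    nlinarith
  have hτ : 0 < θ * ℓ := by positivity
  have hτℓ : θ * ℓ ≤ ℓ := by nlinarith
  obtain ⟨u, hu⟩ := exists_controlledState_eq F G hFG hτ y₀ x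
  have hi := intervalIntegrable_along_controlledState (F := F) (G := G) hφc hM
  refine ⟨concatControl (θ * ℓ) u c, ?_⟩
  have h1 : ‖(∫ s in 0..(θ * ℓ), φ (u s) (controlledState F G y₀ u s)) - (θ * ℓ) • φ v x‖ ≤
      2 * M * (θ * ℓ) := by
    have := norm_integral_sub_smul_le hτ.le (φ v x) (hi y₀ u 0 (θ * ℓ)) (C := 2 * M)
      fun s _ => (norm_sub_le _ _).trans
        (by linarith [hM (u s) (controlledState F G y₀ u s), hM v x])
    simpa using this
  have h2 : ‖(∫ s in 0..(ℓ - θ * ℓ), φ (c s) (controlledState F G x c s)) -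
      (ℓ - θ * ℓ) • φ v x‖ ≤ η / 2 * (ℓ - θ * ℓ) := by
    have := norm_integral_sub_smul_le (sub_nonneg.2 hτℓ) (φ v x) (hi x c 0 (ℓ - θ * ℓ))
      (C := η / 2) fun s hs => by
        have := hball (x := s) (by
          rw [Real.dist_eq, sub_zero, abs_of_nonneg hs.1]
          linarith [hs.2])
        rw [controlledState_zero, dist_eq_norm] at this
        exact this.le
    simpa using this
  have hsplit : ℓ = θ * ℓ + (ℓ - θ * ℓ) := by ring
  have h3 := integral_concatControl_add F G y₀ u c φ hτ.le (sub_nonneg.2 hτℓ)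
  rw [← hsplit, hu] at h3
  rw [← intervalIntegral.integral_add_adjacent_intervals (hi _ _ 0 (θ * ℓ)) (hi _ _ (θ * ℓ) ℓ),
    integral_concatControl_of_le F G y₀ u c φ le_rfl hτ.le le_rfl, h3]
  have hw : ℓ • φ v x = (θ * ℓ) • φ v x + (ℓ - θ * ℓ) • φ v x := by
    rw [← add_smul, ← hsplit]
  rw [hw, add_sub_add_comm]
  refine (norm_add_le _ _).trans ((add_le_add h1 h2).trans ?_)
  nlinarith

theorem steers_smul [CompleteSpace E]
    (hFG : ∀ p : X →L[ℝ] ℝ, (∀ (j : ℕ) v, p ((F ^ j) (G v)) = 0) → p = 0)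
    (hφc : ∀ v, Continuous (φ v)) (hM : ∀ v x, ‖φ v x‖ ≤ M) (v : U) (x : X) {η ℓ : ℝ}
    (hη : 0 < η) (hℓ : 0 < ℓ) : Steers F G φ ℓ (ℓ • φ v x) (η * ℓ) := by
  obtain ⟨ℓ₀, hℓ₀, h⟩ := exists_steers_of_le hFG hφc hM v x hη
  obtain ⟨N, hN⟩ := exists_nat_gt (ℓ / ℓ₀)
  have hN0 : (0 : ℝ) < N := (by positivity : 0 ≤ ℓ / ℓ₀).trans_lt hN
  have hle : ℓ / N ≤ ℓ₀ := by
    rw [div_le_iff₀ hN0]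
    rw [div_lt_iff₀ hℓ₀] at hN
    linarith
  have := (h (ℓ / N) (by positivity) hle).nsmul hφc hM (by positivity) N
  have h1 : (N : ℝ) * (ℓ / N) = ℓ := by field_simp
  have h2 : (N : ℝ) * (η * (ℓ / N)) = η * ℓ := by field_simp
  rwa [smul_smul, h1, h2] at this

/-- The mean values of `φ` that can be approximated over every time span form a convex set: run the
controls one after the other, for times proportional to the weights. -/
theorem convex_setOf_steers (hφc : ∀ v, Continuous (φ v)) (hM : ∀ v x, ‖φ v x‖ ≤ M) :
    Convex ℝ {w : E | ∀ η > 0, ∀ ℓ > 0, Steers F G φ ℓ (ℓ • w) (η * ℓ)} := by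
  rw [convex_iff_forall_pos]
  intro w₁ h₁ w₂ h₂ a b ha hb hab η hη ℓ hℓ
  have := (h₁ η hη (a * ℓ) (by positivity)).add hφc hM (h₂ η hη (b * ℓ) (by positivity))
    (by positivity) (by positivity)
  have e1 : a * ℓ + b * ℓ = ℓ := by rw [← add_mul, hab, one_mul]
  have e2 : η * (a * ℓ) + η * (b * ℓ) = η * ℓ := by rw [← mul_add, e1]
  have e3 : (a * ℓ) • w₁ + (b * ℓ) • w₂ = ℓ • (a • w₁ + b • w₂) := by
    rw [smul_add, smul_smul, smul_smul, mul_comm a, mul_comm b]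
  rwa [e1, e2, e3] at this

omit [FiniteDimensional ℝ X] [SecondCountableTopology E] in
theorem isClosed_setOf_steers :
    IsClosed {w : E | ∀ η > 0, ∀ ℓ > 0, Steers F G φ ℓ (ℓ • w) (η * ℓ)} := by
  refine isClosed_of_closure_subset fun w hw η hη ℓ hℓ y₀ => ?_
  obtain ⟨w', hw', hd⟩ := Metric.mem_closure_iff.1 hw (η / 2) (by positivity)
  obtain ⟨u, hu⟩ := hw' (η / 2) (by positivity) ℓ hℓ y₀
  refine ⟨u, ?_⟩
  have h1 : ‖ℓ • w' - ℓ • w‖ ≤ η / 2 * ℓ := by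
    rw [← smul_sub, norm_smul, Real.norm_of_nonneg hℓ.le, mul_comm]
    rw [dist_comm, dist_eq_norm] at hd
    exact mul_le_mul_of_nonneg_right hd.le hℓ.le
  have h2 := norm_sub_le_norm_sub_add_norm_sub
    (∫ s in 0..ℓ, φ (u s) (controlledState F G y₀ u s)) (ℓ • w') (ℓ • w)
  linarith

omit [SecondCountableTopology E] in
/-- Different tasks can be steered one after the other, on consecutive intervals of length `h`. -/
theorem exists_control_of_steers {h κ : ℝ} (hh : 0 ≤ h) {φ : ℕ → U → X → E} {w : ℕ → E}
    (hs : ∀ i, Steers F G (φ i) h (w i) κ) (y₀ : X) (N : ℕ) :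
    ∃ u : SimpleFunc ℝ U, ∀ i < N,
      ‖(∫ s in (i * h)..(i * h + h), φ i (u s) (controlledState F G y₀ u s)) - w i‖ ≤ κ := by
  induction N with
  | zero => exact ⟨0, fun i hi => absurd hi (Nat.not_lt_zero i)⟩
  | succ N ih =>
    obtain ⟨u, hu⟩ := ih
    obtain ⟨v, hv⟩ := hs N (controlledState F G y₀ u (N * h))
    refine ⟨concatControl (N * h) u v, fun i hi => ?_⟩
    rcases Nat.lt_succ_iff_lt_or_eq.1 hi with hlt | rfl
    · have hle : (i : ℝ) * h + h ≤ N * h := by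
        have : (i : ℝ) + 1 ≤ N := by exact_mod_cast hlt
        nlinarith
      rw [integral_concatControl_of_le F G y₀ u v (φ i) (by positivity) (by linarith) hle]
      exact hu i hlt
    · rw [integral_concatControl_add F G y₀ u v (φ i) (by positivity) hh]
      exact hv

end Steering

/-! ### The Kalman rank condition -/

section Kalman

variable {m k : ℕ}

/-- The rank condition in dual form. The factor `ε⁻¹` comes from solving the fast equation for the
derivative. -/
theorem eq_zero_of_rank_controllabilityMatrix {A : Matrix (Fin m) (Fin m) ℝ}
    {B : Matrix (Fin m) (Fin k) ℝ} (hAB : (controllabilityMatrix A B).rank = m) {ε : ℝ}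
    (hε : ε ≠ 0) (p : EuclideanSpace ℝ (Fin m) →L[ℝ] ℝ)
    (hp : ∀ (j : ℕ) v, p (((ε⁻¹ • LinearMap.toContinuousLinearMap A.toEuclideanLin) ^ j)
      ((ε⁻¹ • LinearMap.toContinuousLinearMap B.toEuclideanLin) v)) = 0) : p = 0 := by
  have hpow : ∀ (j : ℕ) (x : EuclideanSpace ℝ (Fin m)),
      ((ε⁻¹ • LinearMap.toContinuousLinearMap A.toEuclideanLin) ^ j) x =
        (ε⁻¹) ^ j • WithLp.toLp 2 ((A ^ j).mulVec x.ofLp) := by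
    intro j
    induction j with
    | zero => intro x; simp
    | succ j ih =>
      intro x
      rw [pow_succ, ContinuousLinearMap.mul_def, ContinuousLinearMap.comp_apply, ih, pow_succ A,
        ← Matrix.mulVec_mulVec]
      simp [Matrix.mulVec_smul, smul_smul, pow_succ, Matrix.toLpLin_apply]
  have hp' : ∀ (j : ℕ) (v : Fin k → ℝ), p (WithLp.toLp 2 ((A ^ j * B).mulVec v)) = 0 := by
    intro j v
    have := hp j (WithLp.toLp 2 v)
    rw [hpow] at this
    simpa [Matrix.mulVec_smul, Matrix.toLpLin_apply, hε] using this
  have htop : LinearMap.range (controllabilityMatrix A B).mulVecLin = ⊤ := by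
    apply Submodule.eq_top_of_finrank_eq
    rw [Module.finrank_fin_fun]
    exact hAB
  ext x
  obtain ⟨w, hw⟩ := LinearMap.range_eq_top.1 htop x.ofLp
  have hx : x = ∑ j : Fin m, WithLp.toLp 2 ((A ^ (j : ℕ) * B).mulVec fun l => w (j, l)) := by
    ext i
    rw [← hw]
    simp [controllabilityMatrix, Matrix.mulVec, dotProduct, Fintype.sum_prod_type]
  rw [hx, map_sum]
  simp [hp']

end Kalman

/-! ### Approximation of solutions of the inclusion -/

section Approximation

open Metric Filter Topology

variable {m k n : ℕ}
  {g : EuclideanSpace ℝ (Fin k) → EuclideanSpace ℝ (Fin m) → EuclideanSpace ℝ (Fin n) →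
      EuclideanSpace ℝ (Fin n)} {M L T : ℝ}
  {F : EuclideanSpace ℝ (Fin m) →L[ℝ] EuclideanSpace ℝ (Fin m)}
  {G : EuclideanSpace ℝ (Fin k) →L[ℝ] EuclideanSpace ℝ (Fin m)}

theorem steers_of_mem_averagedField
    (hFG : ∀ p : EuclideanSpace ℝ (Fin m) →L[ℝ] ℝ, (∀ (j : ℕ) v, p ((F ^ j) (G v)) = 0) → p = 0)
    (hM : ∀ u y z, ‖g u y z‖ ≤ M) {z : EuclideanSpace ℝ (Fin n)}
    (hgc : ∀ u, Continuous fun y => g u y z) {v : EuclideanSpace ℝ (Fin n)}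
    (hv : v ∈ averagedField g z) {η ℓ : ℝ} (hη : 0 < η) (hℓ : 0 < ℓ) :
    Steers F G (fun u y => g u y z) ℓ (ℓ • v) (η * ℓ) :=
  averagedField_subset (convex_setOf_steers hgc fun u y => hM u y z) isClosed_setOf_steers
    (fun u y _ hη' _ hℓ' => steers_smul hFG hgc (fun u y => hM u y z) u y hη' hℓ') hv η hη ℓ hℓ

theorem continuous_of_lipschitz_pair
    (hg : ∀ u y₁ y₂ z₁ z₂, ‖g u y₁ z₁ - g u y₂ z₂‖ ≤ L * (‖y₁ - y₂‖ + ‖z₁ - z₂‖))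
    (u : EuclideanSpace ℝ (Fin k)) : Continuous fun p : EuclideanSpace ℝ (Fin m) ×
      EuclideanSpace ℝ (Fin n) => g u p.1 p.2 := by
  rw [continuous_iff_continuousAt]
  intro p
  rw [ContinuousAt, tendsto_iff_norm_sub_tendsto_zero]
  have : Tendsto (fun q : EuclideanSpace ℝ (Fin m) × EuclideanSpace ℝ (Fin n) =>
      L * (‖q.1 - p.1‖ + ‖q.2 - p.2‖)) (𝓝 p) (𝓝 (L * (‖p.1 - p.1‖ + ‖p.2 - p.2‖))) :=
    (by fun_prop : Continuous fun q : EuclideanSpace ℝ (Fin m) × EuclideanSpace ℝ (Fin n) =>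
      L * (‖q.1 - p.1‖ + ‖q.2 - p.2‖)).tendsto p
  simp only [sub_self, norm_zero, add_zero, mul_zero] at this
  exact squeeze_zero (fun _ => norm_nonneg _) (fun q => hg u _ _ _ _) this

/-- Along a solution `z` of the inclusion, some control makes the integral of `g (u, y, z)` follow
`z` uniformly: on a fine grid `z` is frozen at the left end of each cell, and the velocity is
steered to the point of `V(z)` nearest to the difference quotient of `z` over the cell. -/
theorem exists_control_tracking (hT : 0 < T) (hL : 0 ≤ L)
    (hFG : ∀ p : EuclideanSpace ℝ (Fin m) →L[ℝ] ℝ, (∀ (j : ℕ) v, p ((F ^ j) (G v)) = 0) → p = 0)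
    (hM : ∀ u y z, ‖g u y z‖ ≤ M)
    (hg : ∀ u y₁ y₂ z₁ z₂, ‖g u y₁ z₁ - g u y₂ z₂‖ ≤ L * (‖y₁ - y₂‖ + ‖z₁ - z₂‖))
    {z : ℝ → EuclideanSpace ℝ (Fin n)} (hzc : Continuous z)
    (hz : ∀ a ∈ Icc 0 T, ∀ b ∈ Icc 0 T, a ≤ b → ‖z b - z a‖ ≤ M * (b - a))
    (hslope : ∀ a ∈ Icc 0 T, ∀ b ∈ Icc 0 T, a < b →
      infDist ((b - a)⁻¹ • (z b - z a)) (averagedField g (z a)) ≤ L * M * (b - a))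
    (y₀ : EuclideanSpace ℝ (Fin m)) {δ : ℝ} (hδ : 0 < δ) :
    ∃ u : SimpleFunc ℝ (EuclideanSpace ℝ (Fin k)), ∀ t ∈ Icc 0 T,
      ‖(∫ s in 0..t, g (u s) (controlledState F G y₀ u s) (z s)) - (z t - z 0)‖ ≤ δ := by
  have hM0 : 0 ≤ M := (norm_nonneg _).trans (hM 0 0 0)
  set c : ℝ := L * M + L * M + 1 with hc
  have hc0 : 0 ≤ c := by positivity
  obtain ⟨N, hN⟩ := exists_nat_gt (T * (T * c + 2 * M) / δ)
  have hN0 : (0 : ℝ) < N := (by positivity : 0 ≤ T * (T * c + 2 * M) / δ).trans_lt hN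
  set h : ℝ := T / N with hh
  have hh0 : 0 < h := by positivity
  have hNh : N * h = T := by rw [hh]; field_simp
  have hsmall : (T * c + 2 * M) * h ≤ δ := by
    rw [div_lt_iff₀ hδ] at hN
    rw [hh, mul_div_assoc', div_le_iff₀ hN0]
    linarith
  have hmem : ∀ i : ℕ, i ≤ N → (i : ℝ) * h ∈ Icc 0 T := fun i hi => by
    refine ⟨by positivity, ?_⟩
    rw [← hNh]
    exact mul_le_mul_of_nonneg_right (by exact_mod_cast hi) hh0.le
  choose v hv hvd using fun i : ℕ => (isClosed_averagedField (g := g) (z (i * h))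
    ).exists_infDist_eq_dist (averagedField_nonempty (z (i * h)))
    (h⁻¹ • (z (i * h + h) - z (i * h)))
  have hgc := continuous_of_lipschitz_pair hg
  obtain ⟨u, hu⟩ := exists_control_of_steers (F := F) (G := G) hh0.le (κ := h * h)
    (φ := fun i u y => g u y (z (i * h))) (w := fun i => h • v i)
    (fun i => steers_of_mem_averagedField hFG hM
      (fun u => (hgc u).comp (continuous_id.prodMk continuous_const)) (hv i) hh0 hh0) y₀ N
  set y := controlledState F G y₀ u with hy
  have hyc : Continuous y := continuous_controlledState F G y₀ u
  have hI : ∀ a b, IntervalIntegrable (fun s => g (u s) (y s) (z s)) volume a b :=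
    intervalIntegrable_of_bound (aestronglyMeasurable_simpleFunc_bind u
      (Φ := fun v s => g v (y s) (z s)) fun v => (hgc v).comp (hyc.prodMk hzc)) fun s => hM _ _ _
  have hI' : ∀ w a b, IntervalIntegrable (fun s => g (u s) (y s) w) volume a b := fun w =>
    intervalIntegrable_of_bound (aestronglyMeasurable_simpleFunc_bind u
      (Φ := fun v s => g v (y s) w) fun v => (hgc v).comp (hyc.prodMk continuous_const))
      fun s => hM _ _ _
  refine ⟨u, ?_⟩
  -- The error made on one cell is quadratic in its length.
  have hcell : ∀ i < N, ‖(∫ s in (i * h)..(i * h + h), g (u s) (y s) (z s)) -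
      (z (i * h + h) - z (i * h))‖ ≤ c * h * h := by
    intro i hi
    have hi0 := hmem i hi.le
    have hi1 : (i : ℝ) * h + h ∈ Icc 0 T := by
      have := hmem (i + 1) hi
      push_cast at this
      rwa [add_mul, one_mul] at this
    have e1 : ‖(∫ s in (i * h)..(i * h + h), g (u s) (y s) (z s)) -
        ∫ s in (i * h)..(i * h + h), g (u s) (y s) (z (i * h))‖ ≤ L * M * h * h := by
      rw [← intervalIntegral.integral_sub (hI _ _) (hI' _ _ _)]
      have := norm_integral_le_of_ae_bound (a := i * h) (b := i * h + h) (M := L * M * h)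
        (f := fun s => g (u s) (y s) (z s) - g (u s) (y s) (z (i * h))) (by linarith)
        (ae_restrict_of_forall_mem measurableSet_Icc fun s hs => by
          have h1 := hg (u s) (y s) (y s) (z s) (z (i * h))
          rw [sub_self, norm_zero, zero_add] at h1
          refine h1.trans ?_
          rw [mul_assoc L]
          refine mul_le_mul_of_nonneg_left ?_ hL
          refine (hz _ hi0 s ⟨hi0.1.trans hs.1, hs.2.trans hi1.2⟩ hs.1).trans ?_
          exact mul_le_mul_of_nonneg_left (by linarith [hs.2]) hM0)
      rwa [add_sub_cancel_left] at this
    have e2 := hu i hi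
    have e3 : ‖h • v i - (z (i * h + h) - z (i * h))‖ ≤ L * M * h * h := by
      have h1 := hslope _ hi0 _ hi1 (by linarith)
      rw [add_sub_cancel_left, hvd i, dist_comm, dist_eq_norm] at h1
      have h2 : h • v i - (z (i * h + h) - z (i * h)) =
          h • (v i - h⁻¹ • (z (i * h + h) - z (i * h))) := by
        rw [smul_sub, smul_inv_smul₀ hh0.ne']
      rw [h2, norm_smul, Real.norm_of_nonneg hh0.le, mul_comm]
      exact mul_le_mul_of_nonneg_right h1 hh0.le
    have e4 := norm_sub_le_norm_sub_add_norm_sub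
      (∫ s in (i * h)..(i * h + h), g (u s) (y s) (z s))
      (∫ s in (i * h)..(i * h + h), g (u s) (y s) (z (i * h))) (z (i * h + h) - z (i * h))
    have e5 := norm_sub_le_norm_sub_add_norm_sub
      (∫ s in (i * h)..(i * h + h), g (u s) (y s) (z (i * h))) (h • v i)
      (z (i * h + h) - z (i * h))
    rw [hc]
    nlinarith
  have hgrid : ∀ i ≤ N, ‖(∫ s in 0..(i * h), g (u s) (y s) (z s)) - (z (i * h) - z 0)‖ ≤
      i * (c * h * h) := by
    intro i
    induction i with
    | zero => intro _; simp
    | succ i ih =>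
      intro hi
      have h1 := ih (Nat.le_of_succ_le hi)
      have h2 := hcell i hi
      push_cast
      rw [add_mul, one_mul, add_mul, one_mul,
        ← intervalIntegral.integral_add_adjacent_intervals (hI 0 (i * h)) (hI _ _),
        ← sub_add_sub_cancel' (z (i * h)) (z 0), add_sub_add_comm]
      exact (norm_add_le _ _).trans (add_le_add h1 h2)
  intro t ht
  set i := ⌊t / h⌋₊ with hi
  have hit : (i : ℝ) * h ≤ t := (le_div_iff₀ hh0).1 (Nat.floor_le (div_nonneg ht.1 hh0.le))
  have hti : t ≤ i * h + h := by
    have := (div_lt_iff₀ hh0).1 (Nat.lt_floor_add_one (t / h))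
    rw [add_mul, one_mul] at this
    exact this.le
  have hiN : i ≤ N := by
    have : (i : ℝ) * h ≤ N * h := hit.trans (by rw [hNh]; exact ht.2)
    exact_mod_cast le_of_mul_le_mul_right this hh0
  have e1 := hgrid i hiN
  have e2 : ‖∫ s in (i * h)..t, g (u s) (y s) (z s)‖ ≤ M * h :=
    (norm_integral_le_of_ae_bound hit (Eventually.of_forall fun s => hM _ _ _)).trans
      (mul_le_mul_of_nonneg_left (by linarith) hM0)
  have e3 : ‖z t - z (i * h)‖ ≤ M * h :=
    (hz _ (hmem i hiN) t ht hit).trans (mul_le_mul_of_nonneg_left (by linarith) hM0)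
  have e4 : (i : ℝ) * (c * h * h) ≤ T * c * h := by
    have : (i : ℝ) * h * (c * h) ≤ T * (c * h) :=
      mul_le_mul_of_nonneg_right (hmem i hiN).2 (by positivity)
    linarith
  rw [← intervalIntegral.integral_add_adjacent_intervals (hI 0 (i * h)) (hI _ _),
    ← sub_add_sub_cancel' (z (i * h)) (z 0), add_sub_add_comm]
  have e5 := norm_sub_le (∫ s in (i * h)..t, g (u s) (y s) (z s)) (z t - z (i * h))
  refine (norm_add_le _ _).trans ?_
  linarith

/-- Density of the slow trajectories: with the control that tracks `z`, the solution `x` of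
`x' = g (u, y, x)` stays close to `z` by Grönwall's inequality. -/
theorem inclusionSolutions_subset_closure {A : Matrix (Fin m) (Fin m) ℝ}
    {B : Matrix (Fin m) (Fin k) ℝ} (hAB : (controllabilityMatrix A B).rank = m)
    (hT : 0 < T) (hL : 0 ≤ L) (hM : ∀ u y z, ‖g u y z‖ ≤ M)
    (hg : ∀ u y₁ y₂ z₁ z₂, ‖g u y₁ z₁ - g u y₂ z₂‖ ≤ L * (‖y₁ - y₂‖ + ‖z₁ - z₂‖))
    (y₀ : EuclideanSpace ℝ (Fin m)) (z₀ : EuclideanSpace ℝ (Fin n)) {ε : ℝ} (hε : 0 < ε) :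
    inclusionSolutions (averagedField g) z₀ T ⊆ closure (slowTrajectories A B g y₀ z₀ T ε) := by
  intro ζ hζ
  have hgz : ∀ u y z₁ z₂, ‖g u y z₁ - g u y z₂‖ ≤ L * ‖z₁ - z₂‖ := fun u y z₁ z₂ => by
    simpa using hg u y y z₁ z₂
  obtain ⟨hζ0, hζs⟩ := (mem_inclusionSolutions_iff hT hL hM hgz z₀ ζ).1 hζ
  obtain ⟨z', hac, hz0', hz', hζz⟩ := hζ
  set z : ℝ → EuclideanSpace ℝ (Fin n) := IccExtend hT.le ζ with hzdef
  have hzc : Continuous z := ζ.continuous.Icc_extend'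
  have hzζ : ∀ (t : ℝ) (ht : t ∈ Icc 0 T), z t = ζ ⟨t, ht⟩ := fun t ht =>
    IccExtend_of_mem hT.le ζ ht
  have hz0 : z 0 = z₀ := by rw [hzζ 0 ⟨le_rfl, hT.le⟩, hζ0]
  have hzlip : ∀ a ∈ Icc 0 T, ∀ b ∈ Icc 0 T, a ≤ b → ‖z b - z a‖ ≤ M * (b - a) := by
    intro a ha b hb hab
    rw [hzζ a ha, hzζ b hb, hζz, hζz]
    exact (integral_deriv_eq_and_norm_sub_le hM hac hz' ha.1 hab hb.2).2
  have hzs : ∀ a ∈ Icc 0 T, ∀ b ∈ Icc 0 T, a < b →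
      infDist ((b - a)⁻¹ • (z b - z a)) (averagedField g (z a)) ≤ L * M * (b - a) := by
    intro a ha b hb hab
    rw [hzζ a ha, hzζ b hb]
    exact hζs ⟨a, ha⟩ ⟨b, hb⟩ hab
  rw [Metric.mem_closure_iff]
  intro ρ hρ
  set F := ε⁻¹ • LinearMap.toContinuousLinearMap A.toEuclideanLin with hF
  set G := ε⁻¹ • LinearMap.toContinuousLinearMap B.toEuclideanLin with hG
  set δ : ℝ := ρ / 2 * Real.exp (-(L * T)) with hδ
  obtain ⟨u, hu⟩ := exists_control_tracking (F := F) (G := G) hT hL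
    (eq_zero_of_rank_controllabilityMatrix hAB hε.ne') hM hg hzc hzlip hzs y₀
    (δ := δ) (by positivity)
  set y := controlledState F G y₀ u with hy
  have hyc : Continuous y := continuous_controlledState F G y₀ u
  have hgc := continuous_of_lipschitz_pair hg
  have hmeas : ∀ x : ℝ → EuclideanSpace ℝ (Fin n), Continuous x →
      AEStronglyMeasurable fun s => g (u s) (y s) (x s) := fun x hx =>
    aestronglyMeasurable_simpleFunc_bind u (Φ := fun v s => g v (y s) (x s))
      fun v => (hgc v).comp (hyc.prodMk hx)
  obtain ⟨x, hxc, hx⟩ := exists_caratheodory_solution (f := fun s x => g (u s) (y s) x) hT.le hL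
    hmeas (fun s x => hM _ _ _) (fun s x₁ x₂ => hgz _ _ _ _) z₀
  obtain ⟨hxac, hxd⟩ := ae_hasDerivAt_of_eq_add_integral hT.le (hmeas x hxc)
    (fun s => hM _ _ _) z₀ hx
  refine ⟨⟨fun t => x t, hxc.comp continuous_subtype_val⟩, ⟨u, y, x,
    { measurable_control := u.measurable
      absolutelyContinuous_fast := absolutelyContinuousOnInterval_controlledState F G y₀ u hT.le
      absolutelyContinuous_slow := hxac
      initial_fast := controlledState_zero F G y₀ u
      initial_slow := by simpa using hx 0 ⟨le_rfl, hT.le⟩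
      fast_equation := ?_
      slow_equation := hxd }, fun t => rfl⟩, ?_⟩
  · refine ae_restrict_of_ae ?_
    filter_upwards [ae_hasDerivAt_controlledState F G y₀ u] with t ht
    refine ⟨_, ht, ?_⟩
    simp [hF, hG, smul_smul, hε.ne', hy]
  have hI : ∀ x : ℝ → EuclideanSpace ℝ (Fin n), Continuous x → ∀ a b,
      IntervalIntegrable (fun s => g (u s) (y s) (x s)) volume a b := fun x hx =>
    intervalIntegrable_of_bound (hmeas x hx) fun s => hM _ _ _
  have hgron := le_mul_exp_of_le_add_integral (e := fun t => ‖x t - z t‖) (by fun_prop)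
    (c := δ) (K := L) (T := T) hL fun t ht => by
      have e1 : x t - z t = (∫ s in 0..t, (g (u s) (y s) (x s) - g (u s) (y s) (z s))) +
          ((∫ s in 0..t, g (u s) (y s) (z s)) - (z t - z 0)) := by
        rw [intervalIntegral.integral_sub (hI x hxc _ _) (hI z hzc _ _), hx t ht, hz0]
        abel
      have e2 : ‖∫ s in 0..t, (g (u s) (y s) (x s) - g (u s) (y s) (z s))‖ ≤
          L * ∫ s in 0..t, ‖x s - z s‖ := by
        rw [← intervalIntegral.integral_const_mul]
        refine intervalIntegral.norm_integral_le_of_norm_le ht.1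
          (Eventually.of_forall fun s _ => hgz _ _ _ _) ?_
        exact (by fun_prop : Continuous fun s => L * ‖x s - z s‖).intervalIntegrable _ _
      rw [e1]
      refine (norm_add_le _ _).trans ?_
      linarith [hu t ht]
  refine lt_of_le_of_lt ((ContinuousMap.dist_le (by positivity)).2 fun t => ?_) (half_lt_self hρ)
  rw [dist_comm, dist_eq_norm, ← hzζ t t.2]
  refine (hgron t t.2).trans ?_
  calc δ * Real.exp (L * t) ≤ δ * Real.exp (L * T) := by
        gcongr
        exact t.2.2
    _ = ρ / 2 := by rw [hδ, mul_assoc, ← Real.exp_add, neg_add_cancel, Real.exp_zero, mul_one]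

/-- Controlled trajectories solve the inclusion, since `g (u, y, z)` belongs to `V(z)`. -/
theorem slowTrajectories_subset_inclusionSolutions (A : Matrix (Fin m) (Fin m) ℝ)
    (B : Matrix (Fin m) (Fin k) ℝ) (y₀ : EuclideanSpace ℝ (Fin m))
    (z₀ : EuclideanSpace ℝ (Fin n)) (T ε : ℝ) :
    slowTrajectories A B g y₀ z₀ T ε ⊆ inclusionSolutions (averagedField g) z₀ T := by
  rintro ζ ⟨u, y, z, h, hζ⟩
  refine ⟨z, h.absolutelyContinuous_slow, h.initial_slow, ?_, hζ⟩
  filter_upwards [h.slow_equation] with t ht using ⟨_, mem_averagedField _ _ _, ht⟩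

end Approximation

theorem theorem1 {m k n : ℕ}
    (A : Matrix (Fin m) (Fin m) ℝ) (B : Matrix (Fin m) (Fin k) ℝ)
    (hAB : (controllabilityMatrix A B).rank = m)
    (g : EuclideanSpace ℝ (Fin k) → EuclideanSpace ℝ (Fin m) → EuclideanSpace ℝ (Fin n) →
      EuclideanSpace ℝ (Fin n))
    (hg_bdd : ∃ M : ℝ, ∀ u y z, ‖g u y z‖ ≤ M)
    (hg_lip : ∃ L : ℝ, ∀ u y₁ y₂ z₁ z₂,
      ‖g u y₁ z₁ - g u y₂ z₂‖ ≤ L * (‖y₁ - y₂‖ + ‖z₁ - z₂‖))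
    (y₀ : EuclideanSpace ℝ (Fin m)) (z₀ : EuclideanSpace ℝ (Fin n))
    (T : ℝ) (hT : 0 < T) (ε : ℝ) (hε : 0 < ε) :
    closure (slowTrajectories A B g y₀ z₀ T ε) =
      inclusionSolutions (averagedField g) z₀ T := by
  obtain ⟨M, hM⟩ := hg_bdd
  obtain ⟨L, hL⟩ := hg_lip
  have hg : ∀ u y₁ y₂ z₁ z₂, ‖g u y₁ z₁ - g u y₂ z₂‖ ≤ |L| * (‖y₁ - y₂‖ + ‖z₁ - z₂‖) :=
    fun u y₁ y₂ z₁ z₂ => (hL u y₁ y₂ z₁ z₂).trans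
      (mul_le_mul_of_nonneg_right (le_abs_self L) (by positivity))
  refine Subset.antisymm ?_
    (inclusionSolutions_subset_closure hAB hT (abs_nonneg L) hM hg y₀ z₀ hε)
  refine closure_minimal (slowTrajectories_subset_inclusionSolutions A B y₀ z₀ T ε)
    (isClosed_inclusionSolutions_averagedField hT (abs_nonneg L) hM (fun u y z₁ z₂ => ?_) z₀)
  simpa using hg u y y z₁ z₂
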